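/- Let $n\ge 2$ be even and let $\rho$ be a state of $n$ qubits $\mathcal A=\{A_1,\dots,A_n\}$, i.e. a positive semidefinite operator of trace one on $(\mathbb C^2)^{\otimes n}$. For $J\subseteq\mathcal A$ let $\rho_J$ be the marginal of $\rho$ on $J$ (the partial trace over the qubits outside $J$), let $S_2(J)=1-\operatorname{Tr}\rho_J^2$ be the linear entropy (so $S_2(\varnothing)=0$), and put $$C_2(J)=\sum_{v\in J}S_2(\{v\})-S_2(J),\qquad I_2(\mathcal A)_\rho=\sum_{\varnothing\ne J\subseteq\mathcal A}(-1)^{|J|-1}S_2(J).$$ Then $C_2$ is monotone, $C_2(I)\le C_2(J)$ for $\varnothing\neq I\subseteq J\subseteq\mathcal A$, so that $G(\varepsilon)=\{\varnothing\ne J\subseteq\mathcal A : C_2(J)\le\varepsilon\}$, $\varepsilon\in\mathbb R$, is a filtration of abstract simplicial complexes. Fix a field $K$ and let $\widetilde\beta_k(\varepsilon)=\dim_K\widetilde H_k(G(\varepsilon);K)$ be the reduced Betti numbers, computed from the augmented simplicial chain complex. Each $\widetilde\beta_k$ is integrable on $(0,\infty)$, and the reduced integrated Euler characteristic $$\widetilde{\mathfrak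 X}_2(\varepsilon)=\sum_{k\ge 0}(-1)^k\int_0^{\varepsilon}\widetilde\beta_k(\varepsilon')\,d\varepsilon'$$ has a limit $\widetilde{\mathfrak X}_2(\infty)$ as $\varepsilon\to\infty$, with $$\widetilde{\mathfrak X}_2(\infty)=I_2(\mathcal A)_\rho=Q_{(n)}^2=\tau_n(\rho).$$ Here $Q_{(n)}^2=\frac1{2^n}\sum_{\iota\in\{0,1,2,3\}^n}(-1)^{|\iota|}Q_\iota^2$ is the Minkowski length of the generalized Bloch vector $Q_\iota=\operatorname{Tr}\bigl(\rho\,(\sigma_{\iota_1}\otimes\cdots\otimes\sigma_{\iota_n})\bigr)$, where $\sigma_0$ is the $2\times 2$ identity matrix, $\sigma_1,\sigma_2,\sigma_3$ are the Pauli matrices and $|\iota|$ is the number of $j$ with $\iota_j\neq0$; and $\tau_n(\rho)=\operatorname{Tr}(\rho\,\sigma_2^{\otimes n}\rho^*\sigma_2^{\otimes n})$ is the $n$-tangle, $\rho^*$ being the entrywise complex conjugate of $\rho$ in the standard product basis. -/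

import Mathlib

open scoped ComplexOrder

noncomputable section

/-! ### Simplicial homology of a finite ordered complex -/

namespace Persistence

variable {n : ℕ}

/-- The simplices with `m` vertices of the augmented complex: the faces of `G` with `m` vertices,
together with the empty simplex when `m = 0`. In the usual grading they have dimension `m - 1`. -/
def Simplex (G : PreAbstractSimplicialComplex (Fin n)) (m : ℕ) : Type :=
  {J : Finset (Fin n) // J.card = m ∧ (J = ∅ ∨ J ∈ G.faces)}

instance (G : PreAbstractSimplicialComplex (Fin n)) (m : ℕ) : DecidableEq (Simplex G m) :=
  inferInstanceAs (DecidableEq {J : Finset (Fin n) // J.card = m ∧ (J = ∅ ∨ J ∈ G.faces)})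

instance (G : PreAbstractSimplicialComplex (Fin n)) (m : ℕ) : Finite (Simplex G m) :=
  inferInstanceAs (Finite {J : Finset (Fin n) // J.card = m ∧ (J = ∅ ∨ J ∈ G.faces)})

instance (G : PreAbstractSimplicialComplex (Fin n)) (m : ℕ) : Fintype (Simplex G m) :=
  Fintype.ofFinite _

/-- The face of a simplex obtained by omitting the vertex `v`. -/
def Simplex.face {G : PreAbstractSimplicialComplex (Fin n)} {m : ℕ} (σ : Simplex G (m + 1))
    (v : Fin n) (hv : v ∈ σ.1) : Simplex G m :=
  ⟨σ.1.erase v, by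
    obtain ⟨J, hc, hJ⟩ := σ
    refine ⟨by rw [Finset.card_erase_of_mem hv, hc]; rfl, ?_⟩
    rcases Finset.eq_empty_or_nonempty (J.erase v) with h | h
    · exact Or.inl h
    · refine Or.inr ?_
      rcases hJ with rfl | hJ
      · simp at hv
      · exact (G.isRelLowerSet_faces hJ).2 (Finset.erase_subset v J) h⟩

/-- Simplicial chains on the simplices with `m` vertices, with coefficients in `K`: a chain
`∑ σ, c σ • σ` is given by its coefficients, and the simplex `σ` itself is `Pi.single σ 1`. -/
abbrev Chain (K : Type*) [Field K] (G : PreAbstractSimplicialComplex (Fin n)) (m : ℕ) : Type _ :=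
  Simplex G m → K

/-- The boundary map of the augmented chain complex. On a simplex with vertices
`v₀ < v₁ < ⋯ < vₘ` it is `∑ i, (-1) ^ i (v₀, …, v̂ᵢ, …, vₘ)`. On a vertex its value is the empty
simplex with coefficient `1`, so that for `m = 0` it is the augmentation `φ`, which sums the
coefficients of a `0`-chain. -/
def boundary (K : Type*) [Field K] (G : PreAbstractSimplicialComplex (Fin n)) (m : ℕ) :
    Chain K G (m + 1) →ₗ[K] Chain K G m :=
  Fintype.linearCombination K fun σ : Simplex G (m + 1) =>
    ∑ v : {v // v ∈ σ.1},
      Pi.single (σ.face v.1 v.2) ((-1 : K) ^ (σ.1.filter (· < v.1)).card)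

/-- `∂ ∘ ∂ = 0`, so boundaries are cycles. -/
theorem boundary_comp_boundary {n : ℕ} (K : Type*) [Field K] (G : PreAbstractSimplicialComplex (Fin n)) (m : ℕ) :
    boundary K G m ∘ₗ boundary K G (m + 1) = 0 := by
  refine LinearMap.pi_ext' fun σ => LinearMap.ext_ring ?_
  simp only [boundary, LinearMap.comp_apply, LinearMap.single_apply,
    Fintype.linearCombination_apply_single, one_smul, map_sum, LinearMap.zero_apply, Finset.smul_sum]
  rw [Finset.sum_sigma']
  refine Finset.sum_involution (fun x _ => ⟨⟨x.2.1, Finset.mem_of_mem_erase x.2.2⟩,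
      ⟨x.1.1, Finset.mem_erase.2 ⟨(Finset.ne_of_mem_erase x.2.2).symm, x.1.2⟩⟩⟩) ?_ ?_ ?_ ?_
  · rintro ⟨⟨v, hv⟩, ⟨w, hw⟩⟩ -
    have hw' : w ∈ σ.1.erase v := hw
    have hwv := Finset.ne_of_mem_erase hw'
    have hwσ := Finset.mem_of_mem_erase hw'
    have key : ∀ v w : Fin n, v ∈ σ.1 → w ∈ σ.1 → v < w →
        (-1:K)^(σ.1.filter (· < v)).card * (-1)^((σ.1.erase v).filter (· < w)).card
        + (-1:K)^(σ.1.filter (· < w)).card * (-1)^((σ.1.erase w).filter (· < v)).card = 0 := by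
      intro v w hv hw h
      rw [Finset.filter_erase, Finset.filter_erase]
      rw [Finset.erase_eq_of_notMem (s := σ.1.filter (· < v)) (by simp [h.le])]
      have : v ∈ σ.1.filter (· < w) := by simp [hv, h]
      have := Finset.card_erase_add_one this
      rw [← this, pow_succ]; ring
    have e : (σ.face v hv).face w hw = (σ.face w hwσ).face v (Finset.mem_erase.2 ⟨hwv.symm, hv⟩) := by
      apply Subtype.ext; exact Finset.erase_right_comm
    simp only [e, ← Pi.single_smul, smul_eq_mul, ← Pi.single_add]
    rw [Pi.single_eq_zero_iff]
    rcases lt_or_gt_of_ne hwv with h | h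
    · rw [add_comm]; exact key w v hwσ hv h
    · exact key v w hv hwσ h
  · rintro ⟨⟨v, hv⟩, ⟨w, hw⟩⟩ - - h
    have := Finset.ne_of_mem_erase (show w ∈ σ.1.erase v from hw)
    simp at h; exact this h.1
  · intros; simp
  · intros; rfl

/-- The reduced simplicial homology `H̃ₖ(G; K) = ker ∂ₖ / im ∂ₖ₊₁`. A `k`-simplex has `k + 1`
vertices, so `∂ₖ` is `boundary K G k`. -/
abbrev ReducedHomology (K : Type*) [Field K] (G : PreAbstractSimplicialComplex (Fin n)) (k : ℕ) :
    Type _ :=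
  LinearMap.ker (boundary K G k) ⧸
    (LinearMap.range (boundary K G (k + 1))).submoduleOf (LinearMap.ker (boundary K G k))

/-- The reduced Betti number `β̃ₖ(G)`. -/
def reducedBetti (K : Type*) [Field K] (G : PreAbstractSimplicialComplex (Fin n)) (k : ℕ) : ℕ :=
  Module.finrank K (ReducedHomology K G k)

/-! ### The sublevel filtration of a monotone functional -/

/-- Monotonicity of a functional on the nonempty subsets of the vertex set. -/
def IsFaceMonotone (F : Finset (Fin n) → ℝ) : Prop :=
  ∀ I J : Finset (Fin n), I.Nonempty → I ⊆ J → F I ≤ F J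

/-- The complex `G(ε) = {J ≠ ∅ : F(J) ≤ ε}`. -/
def sublevelComplex (F : Finset (Fin n) → ℝ) (hF : IsFaceMonotone F) (ε : ℝ) :
    PreAbstractSimplicialComplex (Fin n) where
  faces := {J | J.Nonempty ∧ F J ≤ ε}
  isRelLowerSet_faces := fun {_} hJ =>
    ⟨hJ.1, fun {I} hIJ hI => ⟨hI, (hF I _ hI hIJ).trans hJ.2⟩⟩

/-- The reduced integrated Betti number `𝔅̃ₖ(ε) = ∫₀^ε β̃ₖ(G(ε')) dε'`. -/
def reducedIntegratedBetti (K : Type*) [Field K] (F : Finset (Fin n) → ℝ) (hF : IsFaceMonotone F)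
    (k : ℕ) (ε : ℝ) : ℝ :=
  ∫ t in (0 : ℝ)..ε, (reducedBetti K (sublevelComplex F hF t) k : ℝ)

/-- The reduced integrated Euler characteristic `𝔛̃(ε) = ∑ₖ (-1)ᵏ 𝔅̃ₖ(ε)`. The sum is finite, as
there are no `k`-simplices for `k ≥ n`. -/
def reducedIEC (K : Type*) [Field K] (F : Finset (Fin n) → ℝ) (hF : IsFaceMonotone F)
    (ε : ℝ) : ℝ :=
  ∑' k : ℕ, (-1 : ℝ) ^ k * reducedIntegratedBetti K F hF k ε

end Persistence

/-! ### States of `n` qubits -/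

namespace Qubits

variable {n : ℕ}

/-- Operators on the `n`-qubit space `(ℂ²)^{⊗ n}`, as matrices in the product basis, which is
indexed by `Fin n → Fin 2`. -/
abbrev Operator (n : ℕ) : Type := Matrix (Fin n → Fin 2) (Fin n → Fin 2) ℂ

/-- Density operators: positive semidefinite of trace one. -/
def IsState (ρ : Operator n) : Prop := ρ.PosSemidef ∧ ρ.trace = 1

/-- The reduced operator `ρ_J`: the partial trace of `ρ` over the qubits outside `J`. -/
def marginal (ρ : Operator n) (J : Finset (Fin n)) :
    Matrix ({i // i ∈ J} → Fin 2) ({i // i ∈ J} → Fin 2) ℂ :=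
  fun a b => ∑ c : {i // i ∉ J} → Fin 2,
    ρ ((Equiv.piEquivPiSubtypeProd (· ∈ J) fun _ => Fin 2).symm (a, c))
      ((Equiv.piEquivPiSubtypeProd (· ∈ J) fun _ => Fin 2).symm (b, c))

/-- The linear entropy `S₂(J) = 1 - Tr ρ_J²`. For a Hermitian operator this trace is real, and for
a state `S₂(∅) = 0`. -/
def linearEntropy (ρ : Operator n) (J : Finset (Fin n)) : ℝ :=
  1 - (marginal ρ J * marginal ρ J).trace.re

/-- The deformed total correlation `C₂(J) = ∑_{v ∈ J} S₂(v) - S₂(J)`. -/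
def totalCorrelation (ρ : Operator n) (J : Finset (Fin n)) : ℝ :=
  ∑ v ∈ J, linearEntropy ρ {v} - linearEntropy ρ J

/-- The deformed interaction information `I₂ = ∑_J (-1)^{|J| - 1} S₂(J)` over the nonempty subsets
`J` of the set of qubits; the empty set does not contribute, since `S₂(∅) = 0`. -/
def interactionInformation (ρ : Operator n) : ℝ :=
  ∑ J : Finset (Fin n) with J.Nonempty, (-1 : ℝ) ^ (J.card - 1) * linearEntropy ρ J

/-- The identity `σ₀` and the Pauli matrices `σ₁, σ₂, σ₃`. -/
def pauli : Fin 4 → Matrix (Fin 2) (Fin 2) ℂ :=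
  ![!![1, 0; 0, 1], !![0, 1; 1, 0], !![0, -Complex.I; Complex.I, 0], !![1, 0; 0, -1]]

/-- The Pauli string `σ_{i₁} ⊗ ⋯ ⊗ σ_{iₙ}`. -/
def pauliString (ι : Fin n → Fin 4) : Operator n :=
  fun a b => ∏ j, pauli (ι j) (a j) (b j)

/-- The coordinate `Q_ι = Tr(ρ σ_ι)` of the generalized Bloch vector. -/
def blochVector (ρ : Operator n) (ι : Fin n → Fin 4) : ℂ :=
  (ρ * pauliString ι).trace

/-- The weight `|ι|`: the number of qubits on which `σ_ι` acts nontrivially. -/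
def weight (ι : Fin n → Fin 4) : ℕ := (Finset.univ.filter fun j => ι j ≠ 0).card

/-- The Minkowski length `Q_(n)² = 2⁻ⁿ ∑_ι (-1)^{|ι|} Q_ι²` of the generalized Bloch vector. -/
def minkowskiLength (ρ : Operator n) : ℂ :=
  1 / 2 ^ n * ∑ ι : Fin n → Fin 4, (-1 : ℂ) ^ weight ι * blochVector ρ ι ^ 2

/-- The `n`-tangle `τₙ(ρ) = Tr(ρ σ₂^{⊗ n} ρ* σ₂^{⊗ n})`, where `ρ*` is the entrywise complex
conjugate of `ρ`. -/
def nTangle (ρ : Operator n) : ℂ :=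
  (ρ * pauliString (fun _ => 2) * ρ.map (starRingEnd ℂ) * pauliString (fun _ => 2)).trace

end Qubits

end

/-! Everything reduces to alternating sums over subsets. Write `T_J` for the swap of the qubits in
`J` between two copies and `Fⱼ` for the swap of the single qubit `j`; then Tr ρ_J² = Tr((ρ ⊗ ρ)
T_J).

Topology: while all vertices are present, Euler–Poincaré (`sum_reducedBetti`) gives ∑ (-1)ᵏ β̃ₖ(t) =
∑_{C₂(J) ≤ t} (-1)^{|J|-1} - 1. Integrating up to M ≥ max C₂ (`reducedIEC_eq`) yields ∑ (-1)^{|J|-1}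
(M - C₂(J)) - M. The signs sum to 1, so M cancels and -∑ (-1)^{|J|-1} C₂(J) remains. This is I₂, as
the one-vertex entropies cancel (`sum_totalCorrelation`).

Algebra: summing purities with signs gives I₂ = Tr((ρ ⊗ ρ) ∏ⱼ (1 - Fⱼ)). On one pair of qubits, 1 -
F equals ½ ∑ᵢ ± σᵢ ⊗ σᵢ, which gives the Minkowski length, and also twice the singlet projector,
with entries products of entries of σ₂, which gives the tangle.

Monotonicity of C₂ is subadditivity of S₂, i.e. Tr((ρ ⊗ ρ)(1 - T_I)(1 - T_J)) ≥ 0 for disjoint I, J.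
-/

/-! ### Linear entropies of qubits -/

namespace Qubits

variable {n : ℕ}

/-- The trace of `(ρ ⊗ ρ) T_J`, where `T_J` swaps the qubits in `J` between the two copies. -/
theorem trace_marginal_sq (ρ : Operator n) (J : Finset (Fin n)) :
    (marginal ρ J * marginal ρ J).trace =
      ∑ x, ∑ y, ρ x (J.piecewise y x) * ρ y (J.piecewise x y) := by
  set e := (Equiv.piEquivPiSubtypeProd (· ∈ J) fun _ => Fin 2) with he
  have hp : ∀ a b c d, J.piecewise (e.symm (a, c)) (e.symm (b, d)) = e.symm (a, d) := by
    intro a b c d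
    funext i
    by_cases hi : i ∈ J <;> simp [he, Finset.piecewise, hi]
  rw [← e.symm.sum_comp]
  simp_rw [← e.symm.sum_comp (fun y => ρ _ (J.piecewise y _) * ρ y _), Fintype.sum_prod_type, hp]
  simp only [Matrix.trace, Matrix.diag, Matrix.mul_apply, marginal, Finset.sum_mul_sum]
  refine Finset.sum_congr rfl fun a _ => ?_
  rw [Finset.sum_comm]

/-- With S, T the permutation matrices, A = (1 - S)(1 - T) is Hermitian with A² = 4A, so 4 Tr(NA) =
Tr(ANA) ≥ 0. The vector `w p` is A applied to the basis vector at `p`. -/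
theorem _root_.Matrix.PosSemidef.sum_alternating_involutions_nonneg {P : Type*} [Fintype P]
    {N : Matrix P P ℂ} (hN : N.PosSemidef) {s t : P → P} (hs : Function.Involutive s)
    (ht : Function.Involutive t) (hst : ∀ p, s (t p) = t (s p)) :
    0 ≤ ∑ p, (N p p - N p (s p) - N p (t p) + N p (s (t p))) := by
  classical
  have inv : ∀ (u : P → P), Function.Involutive u → ∀ f : P → ℂ, ∑ p, f (u p) = ∑ p, f p :=
    fun u hu f => Equiv.sum_comp (hu.toPerm u) f
  let w : P → P → ℂ := fun p =>
    Pi.single p 1 - Pi.single (s p) 1 - Pi.single (t p) 1 + Pi.single (s (t p)) 1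
  have h : ∑ p, star (w p) ⬝ᵥ N.mulVec (w p) =
      4 * ∑ p, (N p p - N p (s p) - N p (t p) + N p (s (t p))) := by
    have hu : Function.Involutive fun p => s (t p) := fun p => by
      simp only [← hst, hs _, ht _]
    have e1 := inv s hs fun p => N p p - N p (s p) - N p (t p) + N p (s (t p))
    have e2 := inv t ht fun p => N p p - N p (s p) - N p (t p) + N p (s (t p))
    have e3 := inv _ hu fun p => N p p - N p (s p) - N p (t p) + N p (s (t p))
    have hst' : ∀ p, t (s p) = s (t p) := fun p => (hst p).symm
    have hs' : ∀ p, s (s p) = p := hs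
    have ht' : ∀ p, t (t p) = p := ht
    simp only [hst', hs', ht'] at e1 e2 e3
    -- Reindexing the four copies by 1, s, t and st produces the sixteen terms of the quadratic
    -- forms.
    have : (4 : ℂ) * ∑ p, (N p p - N p (s p) - N p (t p) + N p (s (t p))) =
      ∑ p, (N p p - N p (s p) - N p (t p) + N p (s (t p))) +
      ∑ p, (N p p - N p (s p) - N p (t p) + N p (s (t p))) +
      ∑ p, (N p p - N p (s p) - N p (t p) + N p (s (t p))) +
      ∑ p, (N p p - N p (s p) - N p (t p) + N p (s (t p))) := by ring
    rw [this]
    nth_rewrite 2 [← e1]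
    nth_rewrite 2 [← e2]
    nth_rewrite 2 [← e3]
    simp only [← Finset.sum_add_distrib]
    refine Finset.sum_congr rfl fun p _ => ?_
    have hstar : ∀ q : P, star (Pi.single q (1 : ℂ) : P → ℂ) = Pi.single q 1 := fun q => by
      rw [← Pi.single_star]; simp
    simp only [w, star_add, star_sub, hstar, Matrix.mulVec_add, Matrix.mulVec_sub, add_dotProduct,
      sub_dotProduct, single_dotProduct, one_mul, Pi.add_apply, Pi.sub_apply,
      Matrix.mulVec_single_one, Matrix.col_apply]
    ring
  have h0 : 0 ≤ ∑ p, star (w p) ⬝ᵥ N.mulVec (w p) :=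
    Finset.sum_nonneg fun p _ => hN.dotProduct_mulVec_nonneg _
  rw [h] at h0
  have h4 : (0 : ℂ) ≤ 4⁻¹ := by norm_num [Complex.le_def]
  simpa using mul_nonneg h4 h0

theorem sum_trace_sq {ρ : Operator n} (hρ : IsState ρ) : ∑ x, ∑ y, ρ x x * ρ y y = 1 := by
  have h : ∑ x, ρ x x = 1 := hρ.2
  rw [← Finset.sum_mul_sum, h, one_mul]

theorem linearEntropy_empty {ρ : Operator n} (hρ : IsState ρ) : linearEntropy ρ ∅ = 0 := by
  simp [linearEntropy, trace_marginal_sq, sum_trace_sq hρ]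

/-- Subadditivity of the linear entropy. -/
theorem linearEntropy_union_le {ρ : Operator n} (hρ : IsState ρ) {I J : Finset (Fin n)}
    (hIJ : Disjoint I J) :
    linearEntropy ρ (I ∪ J) ≤ linearEntropy ρ I + linearEntropy ρ J := by
  let N := Matrix.kronecker ρ ρ
  have hN : N.PosSemidef := hρ.1.kronecker hρ.1
  let s : Finset (Fin n) → (Fin n → Fin 2) × (Fin n → Fin 2) → (Fin n → Fin 2) × (Fin n → Fin 2) :=
    fun J p => (J.piecewise p.2 p.1, J.piecewise p.1 p.2)
  have hs : ∀ J, Function.Involutive (s J) := by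
    rintro J ⟨x, y⟩
    simp only [s, Prod.mk.injEq]
    constructor <;> funext i <;> by_cases hi : i ∈ J <;> simp [hi]
  have hu : ∀ I J, Disjoint I J → ∀ p, s I (s J p) = s (I ∪ J) p := by
    rintro I J h ⟨x, y⟩
    simp only [s, Prod.mk.injEq]
    constructor <;> funext i <;> by_cases hi : i ∈ I <;> by_cases hj : i ∈ J <;>
      first
      | exact absurd hj (Finset.disjoint_left.1 h hi)
      | simp [Finset.piecewise, hi, hj]
  -- As T_I T_J = T_{I ∪ J} for disjoint sets, this reads 1 - Tr ρ_I² - Tr ρ_J² + Tr ρ_{I ∪ J}² ≥ 0.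
  have key := hN.sum_alternating_involutions_nonneg (hs I) (hs J) fun p => by
    rw [hu I J hIJ, hu J I hIJ.symm, Finset.union_comm]
  have hP : ∀ J, ∑ p, N p (s J p) = (marginal ρ J * marginal ρ J).trace := by
    intro J
    rw [trace_marginal_sq, Fintype.sum_prod_type]
    rfl
  have h1 : ∑ p, N p p = 1 := by
    rw [← sum_trace_sq hρ, Fintype.sum_prod_type]
    rfl
  simp only [hu I J hIJ, Finset.sum_add_distrib, Finset.sum_sub_distrib, hP, h1] at key
  have := (Complex.le_def.1 key).1
  simp only [Complex.add_re, Complex.sub_re, Complex.one_re, Complex.zero_re] at this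
  simp only [linearEntropy]
  linarith

theorem totalCorrelation_le_insert {ρ : Operator n} (hρ : IsState ρ) (J : Finset (Fin n))
    (v : Fin n) : totalCorrelation ρ J ≤ totalCorrelation ρ (insert v J) := by
  by_cases hv : v ∈ J
  · rw [Finset.insert_eq_of_mem hv]
  · have h := linearEntropy_union_le hρ (Finset.disjoint_singleton_left.2 hv)
    rw [← Finset.insert_eq] at h
    simp only [totalCorrelation, Finset.sum_insert hv]
    linarith

theorem isFaceMonotone_totalCorrelation {ρ : Operator n} (hρ : IsState ρ) :
    Persistence.IsFaceMonotone (totalCorrelation ρ) := by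
  intro I J _ hIJ
  -- Writing the larger set as `T ∪ I` lets the induction run over arbitrary `T`.
  rw [← Finset.union_eq_right.2 hIJ, Finset.union_comm]
  generalize J = T
  induction T using Finset.induction_on with
  | empty => rw [Finset.empty_union]
  | insert v T _ ih =>
    rw [Finset.insert_union]
    exact ih.trans (totalCorrelation_le_insert hρ _ v)

theorem totalCorrelation_singleton (ρ : Operator n) (v : Fin n) : totalCorrelation ρ {v} = 0 := by
  simp [totalCorrelation]

/-! ### Swaps, Pauli strings and the tangle -/

/-- The operator `2⁻¹ ∑ᵢ ± σᵢ ⊗ σᵢ` is the identity minus the swap. -/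
theorem sum_signed_pauli (a b c d : Fin 2) :
    ∑ i : Fin 4, (if i ≠ 0 then (-1 : ℂ) else 1) * (pauli i a b * pauli i c d) =
      2 * ((if b = a ∧ d = c then 1 else 0) - if d = a ∧ b = c then 1 else 0) := by
  fin_cases a <;> fin_cases b <;> fin_cases c <;> fin_cases d <;>
    simp [pauli, Fin.sum_univ_four] <;> norm_num

/-- 1 - F has rank one: it is |s⟩⟨s| for the unnormalized singlet s whose coordinates are the
entries of σ₂. -/
theorem identity_sub_swap_eq_pauli (a b c d : Fin 2) :
    ((if b = a ∧ d = c then (1 : ℂ) else 0) - if d = a ∧ b = c then 1 else 0) =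
      pauli 2 a c * pauli 2 d b := by
  fin_cases a <;> fin_cases b <;> fin_cases c <;> fin_cases d <;> simp [pauli]

/-- `∏ⱼ (1 - Fⱼ)` as a matrix, where `Fⱼ` swaps the `j`-th qubits of two copies. -/
def antisymmetrizer (x x' y y' : Fin n → Fin 2) : ℂ :=
  ∏ j, ((if x j = x' j ∧ y j = y' j then 1 else 0) - if y j = x' j ∧ x j = y' j then 1 else 0)

theorem antisymmetrizer_eq_sum (x x' y y' : Fin n → Fin 2) :
    antisymmetrizer x x' y y' = ∑ J : Finset (Fin n), (-1 : ℂ) ^ J.card *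
      if x' = J.piecewise y x ∧ y' = J.piecewise x y then 1 else 0 := by
  classical
  unfold antisymmetrizer
  -- The swap term goes first so that the subset in `Finset.prod_add` is the set of swapped qubits.
  simp only [sub_eq_neg_add]
  rw [Finset.prod_add, Finset.powerset_univ]
  refine Finset.sum_congr rfl fun J _ => ?_
  rw [Finset.prod_neg, mul_assoc, Finset.prod_ite_zero, Finset.prod_ite_zero]
  simp only [Finset.prod_const_one, ← ite_and, mul_ite, mul_one, mul_zero]
  refine if_congr ?_ rfl rfl
  simp only [funext_iff, Finset.mem_sdiff, Finset.mem_univ, true_and]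
  constructor
  · rintro ⟨h1, h2⟩
    constructor <;> intro i <;> by_cases hi : i ∈ J <;> simp [hi, h1, h2]
  · rintro ⟨h1, h2⟩
    constructor <;> intro i hi <;> simp [h1 i, h2 i, hi]

/-- The sum over Pauli strings factors over the qubits; each contributes 2(1 - Fⱼ), and the 2ⁿ
cancels the normalization. -/
theorem minkowskiLength_eq_sum (ρ : Operator n) :
    minkowskiLength ρ = ∑ x, ∑ x', ∑ y, ∑ y', ρ x x' * ρ y y' * antisymmetrizer x x' y y' := by
  have hA : ∀ x x' y y' : Fin n → Fin 2, ∑ ι : Fin n → Fin 4, (-1 : ℂ) ^ weight ι *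
      (pauliString ι x' x * pauliString ι y' y) = 2 ^ n * antisymmetrizer x x' y y' := by
    intro x x' y y'
    have hw : ∀ ι : Fin n → Fin 4, (-1 : ℂ) ^ weight ι = ∏ j, if ι j ≠ 0 then (-1 : ℂ) else 1 := by
      intro ι
      rw [Finset.prod_ite]
      simp [weight]
    simp only [hw, pauliString, ← Finset.prod_mul_distrib]
    rw [← Fintype.prod_sum fun j i => (if i ≠ 0 then (-1 : ℂ) else 1) *
      (pauli i (x' j) (x j) * pauli i (y' j) (y j))]
    simp only [sum_signed_pauli, Finset.prod_mul_distrib]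
    simp [antisymmetrizer]
  have hB : ∀ ι : Fin n → Fin 4, blochVector ρ ι ^ 2 = ∑ x, ∑ x', ∑ y, ∑ y',
      ρ x x' * ρ y y' * (pauliString ι x' x * pauliString ι y' y) := by
    intro ι
    simp only [blochVector, Matrix.trace, Matrix.diag, Matrix.mul_apply, sq, Finset.sum_mul,
      Finset.mul_sum]
    refine Finset.sum_congr rfl fun x _ => Finset.sum_congr rfl fun x' _ =>
      Finset.sum_congr rfl fun y _ => Finset.sum_congr rfl fun y' _ => by ring
  unfold minkowskiLength
  simp only [hB, Finset.mul_sum]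
  rw [Finset.sum_comm]
  refine Finset.sum_congr rfl fun x _ => ?_
  rw [Finset.sum_comm]
  refine Finset.sum_congr rfl fun x' _ => ?_
  rw [Finset.sum_comm]
  refine Finset.sum_congr rfl fun y _ => ?_
  rw [Finset.sum_comm]
  refine Finset.sum_congr rfl fun y' _ => ?_
  have h := hA x x' y y'
  have h2 : (2 : ℂ) ^ n ≠ 0 := by simp
  rw [← mul_right_inj' h2, mul_left_comm, ← h]
  simp only [Finset.mul_sum]
  refine Finset.sum_congr rfl fun ι _ => ?_
  field_simp

/-- Hermiticity turns ρ* into the transpose of ρ, which plays the second copy. -/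
theorem nTangle_eq_sum {ρ : Operator n} (hρ : ρ.IsHermitian) :
    nTangle ρ = ∑ x, ∑ x', ∑ y, ∑ y', ρ x x' * ρ y y' * antisymmetrizer x x' y y' := by
  have hA : ∀ x x' y y' : Fin n → Fin 2, antisymmetrizer x x' y y' =
      pauliString (fun _ => 2) x' y' * pauliString (fun _ => 2) y x := by
    intro x x' y y'
    simp only [antisymmetrizer, identity_sub_swap_eq_pauli, pauliString, Finset.prod_mul_distrib]
  have hc : ∀ x y, starRingEnd ℂ (ρ x y) = ρ y x := fun x y => hρ.apply y x
  simp only [nTangle, hA, Matrix.trace, Matrix.diag, Matrix.mul_apply, Matrix.map_apply, hc,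
    Finset.sum_mul]
  refine Finset.sum_congr rfl fun x _ => ?_
  symm
  rw [Finset.sum_comm]
  refine Finset.sum_congr rfl fun y _ => ?_
  rw [Finset.sum_comm]
  exact Finset.sum_congr rfl fun y' _ => Finset.sum_congr rfl fun x' _ => by ring

theorem ofReal_trace_marginal_sq {ρ : Operator n} (hρ : ρ.IsHermitian) (J : Finset (Fin n)) :
    (((marginal ρ J * marginal ρ J).trace.re : ℝ) : ℂ) = (marginal ρ J * marginal ρ J).trace := by
  have hm : (marginal ρ J).IsHermitian := by
    ext a b
    simp only [Matrix.conjTranspose_apply, marginal, star_sum]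
    exact Finset.sum_congr rfl fun c _ => hρ.apply _ _
  rw [← Complex.conj_eq_iff_re, starRingEnd_apply, ← Matrix.trace_conjTranspose,
    Matrix.conjTranspose_mul, hm.eq]

/-! ### Alternating sums over subsets -/

theorem sum_alternating_card_eq_zero (hn : 0 < n) :
    ∑ J : Finset (Fin n), (-1 : ℝ) ^ J.card = 0 := by
  have h := Finset.prod_add (fun _ : Fin n => (-1 : ℝ)) (fun _ => 1) Finset.univ
  simpa [hn.ne', Finset.card_univ] using h.symm

theorem sum_nonempty_eq {f : Finset (Fin n) → ℝ} (h0 : f ∅ = 0) :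
    ∑ J : Finset (Fin n) with J.Nonempty, (-1 : ℝ) ^ (J.card - 1) * f J =
      -∑ J, (-1 : ℝ) ^ J.card * f J := by
  rw [Finset.sum_filter, ← Finset.sum_neg_distrib]
  refine Finset.sum_congr rfl fun J _ => ?_
  split_ifs with h
  · obtain ⟨m, hm⟩ := Nat.exists_eq_succ_of_ne_zero (Finset.card_pos.2 h).ne'
    rw [hm, Nat.succ_sub_one, pow_succ]
    ring
  · rw [Finset.not_nonempty_iff_eq_empty.1 h, h0]
    simp

theorem sum_nonempty_alternating_card_eq_one (hn : 0 < n) :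
    ∑ J : Finset (Fin n) with J.Nonempty, (-1 : ℝ) ^ (J.card - 1) = 1 := by
  have h := sum_nonempty_eq (n := n) (f := fun J => if J = ∅ then 0 else 1) (by simp)
  have h1 : ∀ J : Finset (Fin n), (-1 : ℝ) ^ J.card * (if J = ∅ then 0 else 1) =
      (-1 : ℝ) ^ J.card - if J = ∅ then 1 else 0 := by
    intro J
    split_ifs with hJ <;> simp [hJ]
  simp only [h1, Finset.sum_sub_distrib, sum_alternating_card_eq_zero hn,
    Finset.sum_ite_eq', Finset.mem_univ, if_true, zero_sub, neg_neg] at h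
  refine Eq.trans (Finset.sum_congr rfl fun J hJ => ?_) h
  rw [if_neg (Finset.mem_filter.1 hJ).2.ne_empty, mul_one]

theorem interactionInformation_eq_sum (hn : 0 < n) {ρ : Operator n} (hρ : IsState ρ) :
    interactionInformation ρ = ∑ J : Finset (Fin n), (-1) ^ J.card *
      (marginal ρ J * marginal ρ J).trace.re := by
  rw [interactionInformation, sum_nonempty_eq (linearEntropy_empty hρ)]
  simp only [linearEntropy, mul_sub, mul_one, Finset.sum_sub_distrib,
    sum_alternating_card_eq_zero hn]
  ring

theorem interactionInformation_eq_minkowskiLength (hn : 0 < n) {ρ : Operator n} (hρ : IsState ρ) :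
    (interactionInformation ρ : ℂ) = minkowskiLength ρ := by
  rw [interactionInformation_eq_sum hn hρ, minkowskiLength_eq_sum]
  simp only [Complex.ofReal_sum, Complex.ofReal_mul, Complex.ofReal_pow, Complex.ofReal_neg,
    Complex.ofReal_one, ofReal_trace_marginal_sq hρ.1.isHermitian]
  simp only [trace_marginal_sq, antisymmetrizer_eq_sum, Finset.mul_sum]
  rw [Finset.sum_comm]
  refine Finset.sum_congr rfl fun x _ => ?_
  rw [Finset.sum_comm]
  symm
  rw [Finset.sum_comm]
  refine Finset.sum_congr rfl fun y _ => ?_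
  refine (Finset.sum_congr rfl fun x' _ => Finset.sum_comm).trans ?_
  rw [Finset.sum_comm]
  refine Finset.sum_congr rfl fun J _ => ?_
  simp only [mul_ite, mul_one, mul_zero, ite_and]
  simp [mul_comm]

/-- Each vertex lies in as many even as odd sets if there is a second vertex. -/
theorem sum_alternating_card_mem_eq_zero (hn : 2 ≤ n) (v : Fin n) :
    ∑ J : Finset (Fin n), (-1 : ℝ) ^ J.card * (if v ∈ J then 1 else 0) = 0 := by
  obtain ⟨w, hw⟩ : ∃ w : Fin n, w ≠ v := by
    have : Nontrivial (Fin n) := Fin.nontrivial_iff_two_le.2 hn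
    exact exists_ne v
  -- The second summand 0 at `v` removes the subsets omitting `v`; the factor -1 + 1 at `w` makes
  -- the product vanish.
  have h := Finset.prod_add (fun _ : Fin n => (-1 : ℝ)) (fun i => if i = v then 0 else 1)
    Finset.univ
  rw [Finset.prod_eq_zero (Finset.mem_univ w) (by simp [hw]), Finset.powerset_univ] at h
  refine Eq.trans (Finset.sum_congr rfl fun J _ => ?_) h.symm
  rw [Finset.prod_const]
  congr 1
  split_ifs with hv
  · exact (Finset.prod_eq_one fun i hi => if_neg (by rintro rfl; simp [hv] at hi)).symm
  · symm
    refine Finset.prod_eq_zero (Finset.mem_sdiff.2 ⟨Finset.mem_univ v, hv⟩) ?_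
    simp

/-- After exchanging sums, S₂(v) is multiplied by the signed count of sets containing v, which is
zero. -/
theorem sum_totalCorrelation (hn : 2 ≤ n) {ρ : Operator n} (hρ : IsState ρ) :
    ∑ J : Finset (Fin n) with J.Nonempty, (-1 : ℝ) ^ (J.card - 1) * totalCorrelation ρ J =
      -interactionInformation ρ := by
  rw [interactionInformation, sum_nonempty_eq (linearEntropy_empty hρ),
    sum_nonempty_eq (by simp [totalCorrelation, linearEntropy_empty hρ])]
  have h : ∑ J : Finset (Fin n), (-1 : ℝ) ^ J.card * ∑ v ∈ J, linearEntropy ρ {v} = 0 := by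
    have h1 : ∀ J : Finset (Fin n), (-1 : ℝ) ^ J.card * ∑ v ∈ J, linearEntropy ρ {v} =
        ∑ v, linearEntropy ρ {v} * ((-1 : ℝ) ^ J.card * (if v ∈ J then 1 else 0)) := by
      intro J
      rw [Finset.mul_sum, ← Finset.sum_subset (Finset.subset_univ J)]
      · exact Finset.sum_congr rfl fun v hv => by rw [if_pos hv]; ring
      · intro v _ hv; simp [hv]
    simp only [h1]
    rw [Finset.sum_comm]
    simp only [← Finset.mul_sum, sum_alternating_card_mem_eq_zero hn, mul_zero,
      Finset.sum_const_zero]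
  simp only [totalCorrelation, mul_sub, Finset.sum_sub_distrib, h]
  ring

end Qubits

/-! ### Reduced Betti numbers -/

namespace Persistence

variable {n : ℕ} (K : Type*) [Field K] (G : PreAbstractSimplicialComplex (Fin n))

theorem boundary_single {m : ℕ} (σ : Simplex G (m + 1)) :
    boundary K G m (Pi.single σ 1) = ∑ v : {v // v ∈ σ.1},
      Pi.single (σ.face v.1 v.2) ((-1 : K) ^ (σ.1.filter (· < v.1)).card) := by
  simp [boundary, Fintype.linearCombination_apply_single]

theorem reducedBetti_add_finrank_range (k : ℕ) :
    reducedBetti K G k + Module.finrank K (LinearMap.range (boundary K G k)) +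
      Module.finrank K (LinearMap.range (boundary K G (k + 1))) =
      Fintype.card (Simplex G (k + 1)) := by
  have hle : LinearMap.range (boundary K G (k + 1)) ≤ LinearMap.ker (boundary K G k) :=
    LinearMap.range_le_ker_iff.2 (boundary_comp_boundary K G k)
  have h1 := Submodule.finrank_quotient_add_finrank
    ((LinearMap.range (boundary K G (k + 1))).submoduleOf (LinearMap.ker (boundary K G k)))
  have h2 := LinearMap.finrank_range_add_finrank_ker (boundary K G k)
  rw [(Submodule.submoduleOfEquivOfLe hle).finrank_eq] at h1
  rw [Module.finrank_fintype_fun_eq_card] at h2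
  change reducedBetti K G k + _ = _ at h1
  omega

theorem isEmpty_simplex {m : ℕ} (hm : n < m) : IsEmpty (Simplex G m) :=
  ⟨fun σ => by
    have h := Finset.card_le_univ σ.1
    rw [σ.2.1, Fintype.card_fin] at h
    omega⟩

theorem reducedBetti_eq_zero_of_le {k : ℕ} (hk : n ≤ k) : reducedBetti K G k = 0 := by
  have := isEmpty_simplex G (Nat.lt_succ_of_le hk)
  have h := reducedBetti_add_finrank_range K G k
  rw [Fintype.card_eq_zero] at h
  omega

/-- This rank is the source of the -1 in the reduced Euler characteristic. -/
theorem finrank_range_augmentation (hG : ∃ v, {v} ∈ G.faces) :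
    Module.finrank K (LinearMap.range (boundary K G 0)) = 1 := by
  obtain ⟨v, hv⟩ := hG
  let e : Simplex G 0 := ⟨∅, rfl, Or.inl rfl⟩
  have huniq : ∀ τ : Simplex G 0, τ = e := fun τ => Subtype.ext (Finset.card_eq_zero.1 τ.2.1)
  let σ : Simplex G 1 := ⟨{v}, Finset.card_singleton v, Or.inr hv⟩
  have hσ : boundary K G 0 (Pi.single σ 1) = Pi.single e 1 := by
    rw [boundary_single]
    have : Unique {w // w ∈ σ.1} :=
      ⟨⟨⟨v, Finset.mem_singleton_self v⟩⟩, fun w => Subtype.ext (Finset.mem_singleton.1 w.2)⟩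
    have hd : (default : {w // w ∈ σ.1}).1 = v :=
      Finset.mem_singleton.1 (default : {w // w ∈ σ.1}).2
    rw [Fintype.sum_unique, huniq (σ.face _ _), hd]
    simp [σ, Finset.filter_singleton]
  have htop : LinearMap.range (boundary K G 0) = ⊤ := by
    refine LinearMap.range_eq_top.2 fun c => ⟨c e • Pi.single σ 1, ?_⟩
    rw [map_smul, hσ]
    funext τ
    rw [huniq τ]
    simp
  rw [htop, finrank_top, Module.finrank_fintype_fun_eq_card]
  exact Fintype.card_eq_one_iff.2 ⟨e, huniq⟩

theorem card_simplex_add_one (m : ℕ) [DecidablePred (· ∈ G.faces)] :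
    Fintype.card (Simplex G (m + 1)) =
      (Finset.univ.filter fun J : Finset (Fin n) => J.card = m + 1 ∧ J ∈ G.faces).card := by
  rw [← Nat.card_eq_fintype_card, ← Fintype.card_subtype, ← Nat.card_eq_fintype_card]
  refine Nat.card_congr (Equiv.subtypeEquivRight fun J => and_congr_right fun h => ?_)
  refine or_iff_right ?_
  rintro rfl
  simp at h

/-- The Euler–Poincaré formula for the augmented chain complex. -/
theorem sum_reducedBetti (hG : ∃ v, {v} ∈ G.faces) [DecidablePred (· ∈ G.faces)] :
    ∑ k ∈ Finset.range n, (-1 : ℝ) ^ k * reducedBetti K G k =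
      ∑ J : Finset (Fin n) with J.Nonempty ∧ J ∈ G.faces, (-1 : ℝ) ^ (J.card - 1) - 1 := by
  set r : ℕ → ℝ := fun k => Module.finrank K (LinearMap.range (boundary K G k)) with hr
  have hb : ∀ k, (reducedBetti K G k : ℝ) =
      Fintype.card (Simplex G (k + 1)) - r k - r (k + 1) := by
    intro k
    have h := congrArg (Nat.cast : ℕ → ℝ) (reducedBetti_add_finrank_range K G k)
    push_cast at h
    simp only [hr]
    linarith
  -- The ranks telescope, leaving only r 0 = 1 and r n = 0.
  have htel : ∀ N, ∑ k ∈ Finset.range N, (-1 : ℝ) ^ k * (r k + r (k + 1)) =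
      r 0 - (-1) ^ N * r N := by
    intro N
    induction N with
    | zero => simp
    | succ N ih => rw [Finset.sum_range_succ, ih, pow_succ]; ring
  have hr0 : r 0 = 1 := by simp [hr, finrank_range_augmentation K G hG]
  have hrn : r n = 0 := by
    have := isEmpty_simplex G (Nat.lt_succ_self n)
    have h := reducedBetti_add_finrank_range K G n
    rw [Fintype.card_eq_zero] at h
    simp only [hr, Nat.cast_eq_zero]
    omega
  have hcount : ∑ k ∈ Finset.range n, (-1 : ℝ) ^ k * (Fintype.card (Simplex G (k + 1)) : ℝ) =
      ∑ J : Finset (Fin n) with J.Nonempty ∧ J ∈ G.faces, (-1 : ℝ) ^ (J.card - 1) := by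
    rw [← Finset.sum_fiberwise_of_maps_to (t := Finset.range n)
      (g := fun J : Finset (Fin n) => J.card - 1)]
    · refine Finset.sum_congr rfl fun k _ => ?_
      rw [card_simplex_add_one, Finset.sum_congr rfl (g := fun _ => (-1 : ℝ) ^ k)
        (fun J hJ => by rw [(Finset.mem_filter.1 hJ).2]), Finset.sum_const, nsmul_eq_mul, mul_comm,
        Finset.filter_filter]
      congr 3
      ext J
      simp only [Finset.mem_filter, Finset.mem_univ, true_and, ← Finset.card_pos]
      constructor
      · rintro ⟨h, h'⟩; exact ⟨⟨by omega, h'⟩, by omega⟩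
      · rintro ⟨⟨h, h'⟩, h2⟩; exact ⟨by omega, h'⟩
    · intro J hJ
      have h1 := Finset.card_pos.2 (Finset.mem_filter.1 hJ).2.1
      have h2 := Finset.card_le_univ J
      rw [Fintype.card_fin] at h2
      rw [Finset.mem_range]
      omega
  have : ∀ k, (-1 : ℝ) ^ k * reducedBetti K G k =
      (-1 : ℝ) ^ k * (Fintype.card (Simplex G (k + 1)) : ℝ) - (-1 : ℝ) ^ k * (r k + r (k + 1)) := by
    intro k; rw [hb]; ring
  simp only [this, Finset.sum_sub_distrib, hcount, htel, hr0, hrn]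
  ring

/-! ### Acyclicity of the full simplex -/

/-- The join of a simplex with the least vertex. -/
def Simplex.cone {n : ℕ} {G : PreAbstractSimplicialComplex (Fin (n + 1))}
    (hG : ∀ J : Finset (Fin (n + 1)), J.Nonempty → J ∈ G.faces) {m : ℕ} (σ : Simplex G m)
    (h : 0 ∉ σ.1) : Simplex G (m + 1) :=
  ⟨insert 0 σ.1, by rw [Finset.card_insert_of_notMem h, σ.2.1],
    Or.inr (hG _ (Finset.insert_nonempty _ _))⟩

/-- The cone operator of the full simplex with apex the least vertex. -/
noncomputable def coneOperator {n : ℕ} (G : PreAbstractSimplicialComplex (Fin (n + 1)))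
    (hG : ∀ J : Finset (Fin (n + 1)), J.Nonempty → J ∈ G.faces) (m : ℕ) :
    Chain K G m →ₗ[K] Chain K G (m + 1) :=
  Fintype.linearCombination K fun σ : Simplex G m =>
    if h : 0 ∈ σ.1 then 0 else Pi.single (σ.cone hG h) 1

theorem coneOperator_single {n : ℕ} (G : PreAbstractSimplicialComplex (Fin (n + 1)))
    (hG : ∀ J : Finset (Fin (n + 1)), J.Nonempty → J ∈ G.faces) {m : ℕ} (σ : Simplex G m) (c : K) :
    coneOperator K G hG m (Pi.single σ c) =
      if h : 0 ∈ σ.1 then 0 else Pi.single (σ.cone hG h) c := by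
  rw [coneOperator, Fintype.linearCombination_apply_single]
  split_ifs with h
  · simp
  · simp [← Pi.single_smul]

/-- If σ contains the apex, only the face omitting it survives the cone. Otherwise omitting the apex
from the cone returns σ, and the other faces cancel. -/
theorem coneOperator_homotopy {n : ℕ} (G : PreAbstractSimplicialComplex (Fin (n + 1)))
    (hG : ∀ J : Finset (Fin (n + 1)), J.Nonempty → J ∈ G.faces) (m : ℕ) :
    boundary K G (m + 1) ∘ₗ coneOperator K G hG (m + 1) +
      coneOperator K G hG m ∘ₗ boundary K G m = LinearMap.id := by
  refine LinearMap.pi_ext' fun σ => LinearMap.ext_ring ?_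
  simp only [LinearMap.comp_apply, LinearMap.single_apply, LinearMap.add_apply, LinearMap.id_apply]
  rw [boundary_single, map_sum, coneOperator_single]
  by_cases h : 0 ∈ σ.1
  · rw [dif_pos h, map_zero, zero_add, Finset.sum_eq_single ⟨0, h⟩]
    · rw [coneOperator_single, dif_neg (by exact Finset.notMem_erase 0 σ.1)]
      have e : (σ.1.filter (· < (0 : Fin (n + 1)))) = ∅ := by simp
      simp only [e, Finset.card_empty, pow_zero]
      congr 1
      exact Subtype.ext (Finset.insert_erase h)
    · rintro ⟨v, hv⟩ - hne
      rw [coneOperator_single, dif_pos]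
      exact Finset.mem_erase.2 ⟨fun h0 => hne (Subtype.ext h0.symm), h⟩
    · intro h'; exact absurd (Finset.mem_univ _) h'
  · rw [dif_neg h, boundary_single]
    have hsplit : ∀ f : {v // v ∈ insert 0 σ.1} → Chain K G (m + 1),
        ∑ v, f v = f ⟨0, Finset.mem_insert_self _ _⟩ +
          ∑ v : {v // v ∈ σ.1}, f ⟨v.1, Finset.mem_insert_of_mem v.2⟩ := by
      intro f
      rw [← (Finset.subtypeInsertEquivOption h).symm.sum_comp, Fintype.sum_option]
      rfl
    have hmem : ∀ v : {v // v ∈ σ.1}, v.1 ∈ (σ.cone hG h).1 :=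
      fun v => Finset.mem_insert_of_mem v.2
    have h0 : (0 : Fin (n + 1)) ∈ (σ.cone hG h).1 := Finset.mem_insert_self _ _
    refine (congrArg (· + _) (hsplit _)).trans ?_
    rw [add_assoc, ← Finset.sum_add_distrib, Finset.sum_eq_zero, add_zero]
    · have e : ((σ.cone hG h).1.filter (· < (0 : Fin (n + 1)))) = ∅ := by simp
      have e' : (σ.cone hG h).face 0 h0 = σ := Subtype.ext (Finset.erase_insert h)
      change (Pi.single ((σ.cone hG h).face 0 h0)
        ((-1 : K) ^ ((σ.cone hG h).1.filter (· < (0 : Fin (n + 1)))).card) : Chain K G (m + 1)) = _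
      rw [e, e', Finset.card_empty, pow_zero]
    · rintro ⟨v, hv⟩ -
      have hne : v ≠ 0 := fun h' => h (h' ▸ hv)
      have h' : (0 : Fin (n + 1)) ∉ (σ.face v hv).1 := fun h' => h (Finset.mem_of_mem_erase h')
      rw [coneOperator_single, dif_neg h']
      have e : (σ.cone hG h).face v (hmem ⟨v, hv⟩) = (σ.face v hv).cone hG h' :=
        Subtype.ext (Finset.erase_insert_of_ne hne.symm)
      -- The apex is least, so it shifts every position by one and flips the sign.
      have ec : ((σ.cone hG h).1.filter (· < v)).card = (σ.1.filter (· < v)).card + 1 := by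
        change ((insert 0 σ.1).filter (· < v)).card = _
        rw [Finset.filter_insert, if_pos (Fin.pos_of_ne_zero hne), Finset.card_insert_of_notMem]
        exact fun h' => h (Finset.mem_of_mem_filter _ h')
      change (Pi.single ((σ.cone hG h).face v (hmem ⟨v, hv⟩))
        ((-1 : K) ^ ((σ.cone hG h).1.filter (· < v)).card) : Chain K G (m + 1)) + _ = _
      rw [e, ec, ← Pi.single_add, pow_succ]
      simp

theorem reducedBetti_eq_zero_of_full (hn : 0 < n)
    (hG : ∀ J : Finset (Fin n), J.Nonempty → J ∈ G.faces) (k : ℕ) : reducedBetti K G k = 0 := by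
  obtain ⟨n, rfl⟩ := Nat.exists_eq_succ_of_ne_zero hn.ne'
  have hle : LinearMap.ker (boundary K G k) ≤ LinearMap.range (boundary K G (k + 1)) := by
    intro c hc
    have h := LinearMap.congr_fun (coneOperator_homotopy K G hG k) c
    rw [LinearMap.add_apply, LinearMap.comp_apply, LinearMap.comp_apply, LinearMap.mem_ker.1 hc,
      map_zero, add_zero] at h
    exact ⟨_, h⟩
  have h1 := Submodule.finrank_mono hle
  have h2 := LinearMap.finrank_range_add_finrank_ker (boundary K G k)
  have h3 := reducedBetti_add_finrank_range K G k
  rw [Module.finrank_fintype_fun_eq_card] at h2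
  omega

/-! ### Integration along the filtration -/

variable (F : Finset (Fin n) → ℝ) (hF : IsFaceMonotone F)

/-- The complex depends on `t` only through the finite family `S t`, whose level sets are
intersections of half-lines. -/
theorem measurable_reducedBetti_sublevelComplex (k : ℕ) :
    Measurable fun t : ℝ => (reducedBetti K (sublevelComplex F hF t) k : ℝ) := by
  let S : ℝ → Finset (Finset (Fin n)) := fun t => Finset.univ.filter fun J => F J ≤ t
  let _ : MeasurableSpace (Finset (Finset (Fin n))) := ⊤
  have : DiscreteMeasurableSpace (Finset (Finset (Fin n))) := ⟨fun _ => trivial⟩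
  have hS : Measurable S := by
    refine measurable_to_countable' fun A => ?_
    have : S ⁻¹' {A} = ⋂ J, {t | F J ≤ t ↔ J ∈ A} := by
      ext t
      simp [S, Finset.ext_iff]
    rw [this]
    refine MeasurableSet.iInter fun J => ?_
    by_cases hJ : J ∈ A
    · simp only [hJ, iff_true]
      exact measurableSet_Ici
    · simp only [hJ, iff_false, not_le]
      exact measurableSet_Iio
  have hfac : Function.FactorsThrough
      (fun t : ℝ => (reducedBetti K (sublevelComplex F hF t) k : ℝ)) S := by
    intro t t' h
    have : sublevelComplex F hF t = sublevelComplex F hF t' := by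
      ext J
      have := Finset.ext_iff.1 h J
      simp only [S, Finset.mem_filter, Finset.mem_univ, true_and] at this
      exact and_congr_right fun _ => this
    simp only [this]
  obtain ⟨g, hg⟩ := (Function.factorsThrough_iff _).1 hfac
  rw [hg]
  exact (measurable_of_countable g).comp hS

theorem reducedBetti_le (k : ℕ) : reducedBetti K G k ≤ Fintype.card (Finset (Fin n)) := by
  have h := reducedBetti_add_finrank_range K G k
  have h' : Fintype.card (Simplex G (k + 1)) ≤ Fintype.card (Finset (Fin n)) :=
    Fintype.card_le_of_injective (fun σ => σ.1) Subtype.val_injective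
  omega

theorem integrableOn_reducedBetti_sublevelComplex (k : ℕ) {s : Set ℝ}
    (hs : MeasureTheory.volume s ≠ ⊤) :
    MeasureTheory.IntegrableOn
      (fun t : ℝ => (reducedBetti K (sublevelComplex F hF t) k : ℝ)) s := by
  refine MeasureTheory.Measure.integrableOn_of_bounded (M := Fintype.card (Finset (Fin n))) hs
    (measurable_reducedBetti_sublevelComplex K F hF k).aestronglyMeasurable (.of_forall fun t => ?_)
  rw [Real.norm_natCast]
  exact_mod_cast reducedBetti_le K _ k

theorem exists_forall_le_of_finset : ∃ M, 0 ≤ M ∧ ∀ J, F J ≤ M := by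
  refine ⟨∑ J, |F J|, Finset.sum_nonneg fun _ _ => abs_nonneg _, fun J => (le_abs_self _).trans ?_⟩
  exact Finset.single_le_sum (f := fun J => |F J|) (fun _ _ => abs_nonneg _) (Finset.mem_univ J)

/-- Beyond a bound M of F the complex is the full simplex, which is acyclic; on (0, M] the Betti
number is bounded. -/
theorem integrableOn_Ioi_reducedBetti_sublevelComplex (hn : 0 < n) (k : ℕ) :
    MeasureTheory.IntegrableOn
      (fun t : ℝ => (reducedBetti K (sublevelComplex F hF t) k : ℝ)) (Set.Ioi 0) := by
  obtain ⟨M, hM0, hM⟩ := exists_forall_le_of_finset F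
  rw [← Set.Ioc_union_Ioi_eq_Ioi hM0]
  refine (integrableOn_reducedBetti_sublevelComplex K F hF k (by simp)).union ?_
  refine MeasureTheory.integrableOn_zero.congr_fun (fun t ht => ?_) measurableSet_Ioi
  have h := reducedBetti_eq_zero_of_full K (sublevelComplex F hF t) hn
    (fun J hJ => ⟨hJ, (hM J).trans (le_of_lt ht)⟩) k
  simp [h]

theorem intervalIntegrable_step (c a b : ℝ) :
    IntervalIntegrable (fun t => if c ≤ t then (1 : ℝ) else 0) MeasureTheory.volume a b := by
  refine Monotone.intervalIntegrable fun s t hst => ?_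
  split_ifs with h1 h2
  · exact le_rfl
  · exact absurd (h1.trans hst) h2
  · exact zero_le_one
  · exact le_rfl

theorem integral_step {c M : ℝ} (h0 : 0 ≤ c) (hM : c ≤ M) :
    ∫ t in (0 : ℝ)..M, (if c ≤ t then (1 : ℝ) else 0) = M - c := by
  rw [← intervalIntegral.integral_add_adjacent_intervals (intervalIntegrable_step c 0 c)
    (intervalIntegrable_step c c M)]
  have h1 : ∫ t in (0 : ℝ)..c, (if c ≤ t then (1 : ℝ) else 0) = ∫ t in (0 : ℝ)..c, (0 : ℝ) := by
    -- The step function is already 1 at c, so this endpoint is discarded.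
    rw [intervalIntegral.integral_of_le h0, intervalIntegral.integral_of_le h0,
      MeasureTheory.integral_Ioc_eq_integral_Ioo, MeasureTheory.integral_Ioc_eq_integral_Ioo]
    exact MeasureTheory.setIntegral_congr_fun measurableSet_Ioo fun t ht => if_neg (not_le.2 ht.2)
  have h2 : ∫ t in c..M, (if c ≤ t then (1 : ℝ) else 0) = ∫ t in c..M, (1 : ℝ) :=
    intervalIntegral.integral_congr fun t ht => if_pos (Set.uIcc_of_le hM ▸ ht).1
  rw [h1, h2]
  simp

/-- A face J is present for a time M - F J. Since vertices have value 0, the complex is nonempty on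
all of [0, M], so the -1 integrates to -M, and monotonicity gives F J ≥ 0. -/
theorem reducedIEC_eq (hn : 0 < n) (h0 : ∀ v, F {v} = 0) {M : ℝ} (hM0 : 0 ≤ M)
    (hM : ∀ J, F J ≤ M) :
    reducedIEC K F hF M =
      ∑ J : Finset (Fin n) with J.Nonempty, (-1 : ℝ) ^ (J.card - 1) * (M - F J) - M := by
  classical
  have hint : ∀ k, IntervalIntegrable
      (fun t : ℝ => (reducedBetti K (sublevelComplex F hF t) k : ℝ)) MeasureTheory.volume 0 M :=
    fun k => (intervalIntegrable_iff_integrableOn_Ioc_of_le hM0).2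
      (integrableOn_reducedBetti_sublevelComplex K F hF k (by simp))
  have hpos : ∀ J : Finset (Fin n), J.Nonempty → 0 ≤ F J := by
    rintro J ⟨v, hv⟩
    exact (h0 v).ge.trans (hF {v} J (Finset.singleton_nonempty v) (Finset.singleton_subset_iff.2 hv))
  unfold reducedIEC reducedIntegratedBetti
  rw [tsum_eq_sum (s := Finset.range n) fun k hk => by
    simp [reducedBetti_eq_zero_of_le K _ (not_lt.1 (Finset.mem_range.not.1 hk))]]
  simp only [← intervalIntegral.integral_const_mul]
  rw [← intervalIntegral.integral_finsetSum fun k _ => (hint k).const_mul _]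
  have hpt : Set.EqOn (fun t : ℝ => ∑ k ∈ Finset.range n,
      (-1 : ℝ) ^ k * (reducedBetti K (sublevelComplex F hF t) k : ℝ))
      (fun t => ∑ J : Finset (Fin n) with J.Nonempty,
        (-1 : ℝ) ^ (J.card - 1) * (if F J ≤ t then (1 : ℝ) else 0) - 1) (Set.uIcc 0 M) := by
    intro t ht
    rw [Set.uIcc_of_le hM0] at ht
    dsimp only
    rw [sum_reducedBetti K (sublevelComplex F hF t) ⟨⟨0, hn⟩,
      Finset.singleton_nonempty _, (h0 _).trans_le ht.1⟩]
    simp only [mul_ite, mul_one, mul_zero, ← Finset.sum_filter, Finset.filter_filter]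
    congr 2
    ext J
    simp [sublevelComplex]
  have hsum : IntervalIntegrable (fun t : ℝ => ∑ J : Finset (Fin n) with J.Nonempty,
      (-1 : ℝ) ^ (J.card - 1) * (if F J ≤ t then (1 : ℝ) else 0)) MeasureTheory.volume 0 M := by
    simpa only [Finset.sum_fn] using IntervalIntegrable.sum
      (Finset.univ.filter fun J : Finset (Fin n) => J.Nonempty)
      fun J _ => (intervalIntegrable_step (F J) 0 M).const_mul ((-1 : ℝ) ^ (J.card - 1))
  rw [intervalIntegral.integral_congr hpt, intervalIntegral.integral_sub hsum (by simp),
    intervalIntegral.integral_finsetSum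
      fun J _ => (intervalIntegrable_step _ _ _).const_mul _]
  simp only [intervalIntegral.integral_const_mul]
  rw [intervalIntegral.integral_const, smul_eq_mul, sub_zero, mul_one]
  congr 1
  refine Finset.sum_congr rfl fun J hJ => ?_
  rw [integral_step (hpos J (Finset.mem_filter.1 hJ).2) (hM J)]

end Persistence

/-! ### The limit and its three expressions -/

theorem mainTheorem2 (n : ℕ) (hn0 : 0 < n) (hn : Even n) (ρ : Qubits.Operator n)
    (hρ : Qubits.IsState ρ) (K : Type*) [Field K] :
    ∃ hC : Persistence.IsFaceMonotone (Qubits.totalCorrelation ρ),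
      (∀ k : ℕ, MeasureTheory.IntegrableOn
        (fun ε : ℝ => (Persistence.reducedBetti K
          (Persistence.sublevelComplex (Qubits.totalCorrelation ρ) hC ε) k : ℝ)) (Set.Ioi 0)) ∧
      Filter.Tendsto (Persistence.reducedIEC K (Qubits.totalCorrelation ρ) hC) Filter.atTop
        (nhds (Qubits.interactionInformation ρ)) ∧
      (Qubits.interactionInformation ρ : ℂ) = Qubits.minkowskiLength ρ ∧
      Qubits.minkowskiLength ρ = Qubits.nTangle ρ := by
  have hn2 : 2 ≤ n := by
    obtain ⟨m, rfl⟩ := hn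
    omega
  refine ⟨Qubits.isFaceMonotone_totalCorrelation hρ,
    fun k => Persistence.integrableOn_Ioi_reducedBetti_sublevelComplex K _ _ hn0 k, ?_,
    Qubits.interactionInformation_eq_minkowskiLength hn0 hρ, ?_⟩
  · obtain ⟨M, hM0, hM⟩ := Persistence.exists_forall_le_of_finset (Qubits.totalCorrelation ρ)
    -- The characteristic is constant from M on: the coefficient of ε there is 1 - 1 = 0.
    refine tendsto_const_nhds.congr' ?_
    filter_upwards [Filter.eventually_ge_atTop M] with ε hε
    rw [Persistence.reducedIEC_eq K _ _ hn0 (Qubits.totalCorrelation_singleton ρ) (hM0.trans hε)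
      fun J => (hM J).trans hε]
    simp only [mul_sub, Finset.sum_sub_distrib, ← Finset.sum_mul,
      Qubits.sum_nonempty_alternating_card_eq_one hn0,
      Qubits.sum_totalCorrelation hn2 hρ]
    ring
  · rw [Qubits.minkowskiLength_eq_sum, Qubits.nTangle_eq_sum hρ.1.isHermitian]
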